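/- Let $I\subset\mathbb{R}$ be an open interval containing $0$ and let $\gamma: I\to\mathbb{R}^2$ be a $C^\infty$ curve. Put $$A=\det\big(\gamma^{(5)}(0),\gamma^{(4)}(0)\big),\quad B=\det\big(\gamma^{(6)}(0),\gamma^{(4)}(0)\big),\quad C=\det\big(\gamma^{(7)}(0),\gamma^{(4)}(0)\big),\quad D=\det\big(\gamma^{(6)}(0),\gamma^{(5)}(0)\big).$$ Two germs at $t=0$ of $C^\infty$ plane curves $\gamma_1,\gamma_2$ are called $\mathcal{A}$-equivalent at $t=0$ if there are germs of $C^\infty$ diffeomorphisms $\psi:(\mathbb{R},0)\to(\mathbb{R},0)$ and $\Psi:(\mathbb{R}^2,\gamma_1(0))\to(\mathbb{R}^2,\gamma_2(0))$ such that $\Psi\circ\gamma_1\circ\psi^{-1}=\gamma_2$ as germs at $0$. Then $\gamma$ is $\mathcal{A}$-equivalent to the curve $t\mapsto(t^4,t^5)$ at $t=0$ if and only if $$\gamma'(0)=\gamma''(0)=\gamma'''(0)=\mathbf{0},\qquad A\neq 0\qquad\text{and}\qquad -77B^2+105AD+60AC=0.$$ -/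

import Mathlib

open Set Filter
open scoped Topology ContDiff

/-- `φ` represents a germ of `C^r` diffeomorphism `(E, p) → (F, q)`: it is a bijection from an open
neighbourhood of `p` onto an open neighbourhood of `q = φ p`, and `φ` and its inverse are `C^r`. -/
structure IsDiffeoGerm {E F : Type*} [NormedAddCommGroup E] [NormedSpace ℝ E]
    [NormedAddCommGroup F] [NormedSpace ℝ F] (r : WithTop ℕ∞)
    (φ : OpenPartialHomeomorph E F) (p : E) (q : F) : Prop where
  mem_source : p ∈ φ.source
  map_eq : φ p = q
  contDiffOn : ContDiffOn ℝ r φ φ.source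
  contDiffOn_symm : ContDiffOn ℝ r φ.symm φ.target

/-- The germs at `t = 0` of the plane curves `γ₁` and `γ₂` are `C^r`-equivalent: there are germs of
`C^r` diffeomorphisms `ψ : (ℝ, 0) → (ℝ, 0)` and `Ψ : (ℝ², γ₁ 0) → (ℝ², γ₂ 0)` with
`Ψ ∘ γ₁ ∘ ψ⁻¹ = γ₂` as germs at `0`. -/
def CrEquivalentAtZero (r : WithTop ℕ∞) (γ₁ γ₂ : ℝ → ℝ × ℝ) : Prop :=
  ∃ (ψ : OpenPartialHomeomorph ℝ ℝ) (Ψ : OpenPartialHomeomorph (ℝ × ℝ) (ℝ × ℝ)),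
    IsDiffeoGerm r ψ 0 0 ∧ IsDiffeoGerm r Ψ (γ₁ 0) (γ₂ 0) ∧
      (fun t => Ψ (γ₁ (ψ.symm t))) =ᶠ[𝓝 0] γ₂

/-- `𝒜`-equivalence at `t = 0`, that is, `C^∞`-equivalence. -/
def AEquivalentAtZero (γ₁ γ₂ : ℝ → ℝ × ℝ) : Prop :=
  CrEquivalentAtZero ∞ γ₁ γ₂

/-- The standard `(n, m)`-cusp `t ↦ (t^n, t^m)`. -/
def standardCusp (n m : ℕ) : ℝ → ℝ × ℝ := fun t => (t ^ n, t ^ m)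

/-- The determinant of the `2 × 2` matrix with columns `u` and `v`. -/
def planeDet (u v : ℝ × ℝ) : ℝ := Matrix.det !![u.1, v.1; u.2, v.2]

/-! The exponents of monomials in `(t ^ 4, t ^ 5)` form the semigroup generated by 4 and 5, with
gaps 1, 2, 3, 6, 7, 11.

Necessity: if `γ` is equivalent to the cusp, then near 0 it is `Φ (φ t ^ 4, φ t ^ 5)` with `Φ`, `φ`
smooth and of invertible derivative at 0. Below order 8 only the affine part of `Φ` is seen
(`hasQuarticGerm_comp_cusp`), so the Taylor coefficients of orders 4 to 7 are explicit in that part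
and the cubic jet of `φ t / t`. The relation is then a polynomial identity, and `A` is a nonzero
multiple of the Jacobian of `Φ`.

Sufficiency: a reparametrization has to remove the gaps 6, 7 and 11 from both components. Orders 6
and 7 give four equations in three unknowns, and the relation is their compatibility condition
(`exists_reparametrization_coefficients`). Order 11 gives two equations in two unknowns, solvable
since `A ≠ 0` (`HasQuarticGerm.exists_eq_comp`). With no gaps left, both components are smooth
functions of `(t ^ 4, t ^ 5)` (`exists_factor_through_cusp`, by Borel's lemma and the smoothness of
flat functions of a fifth root), and the inverse function theorem gives the diffeomorphism of the
plane. -/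

/-! ### Hadamard's lemma and Taylor's formula with smooth remainder -/

/-- The weighted average of `φ (t x)` over `x ∈ [0, 1]`. -/
noncomputable def dilationMean (n : ℕ) (φ : ℝ → ℝ) (t : ℝ) : ℝ :=
  ∫ x in (0 : ℝ)..1, x ^ n * φ (t * x)

theorem hasDerivAt_dilationMean (n : ℕ) {φ : ℝ → ℝ} (hφ : ContDiff ℝ ∞ φ) (t : ℝ) :
    HasDerivAt (dilationMean n φ) (dilationMean (n + 1) (deriv φ) t) t := by
  have hφ' : ContDiff ℝ ∞ (deriv φ) := (contDiff_infty_iff_deriv.1 hφ).2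
  have hc := hφ.continuous
  have hc' := hφ'.continuous
  obtain ⟨C, hC⟩ := ((isCompact_closedBall t 1).prod
    (isCompact_Icc (a := (0 : ℝ)) (b := 1))).exists_bound_of_continuousOn
    (f := fun z : ℝ × ℝ => z.2 ^ (n + 1) * deriv φ (z.1 * z.2)) (by fun_prop)
  refine (intervalIntegral.hasDerivAt_integral_of_dominated_loc_of_deriv_le
    (F := fun s x => x ^ n * φ (s * x)) (F' := fun s x => x ^ (n + 1) * deriv φ (s * x))
    (bound := fun _ => C) (Metric.closedBall_mem_nhds t one_pos) ?_ ?_ ?_ ?_ ?_ ?_).2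
  · exact Eventually.of_forall fun s => (by fun_prop : Continuous _).aestronglyMeasurable
  · exact (by fun_prop : Continuous _).intervalIntegrable _ _
  · exact (by fun_prop : Continuous _).aestronglyMeasurable
  · refine Eventually.of_forall fun x hx s hs => hC (s, x) ⟨hs, ?_⟩
    rw [uIoc_of_le zero_le_one] at hx
    exact ⟨hx.1.le, hx.2⟩
  · exact intervalIntegrable_const
  · refine Eventually.of_forall fun x _ s _ => ?_
    have h1 : HasDerivAt (fun s => φ (s * x)) (deriv φ (s * x) * (1 * x)) s :=
      ((hφ.differentiable (by simp)) (s * x)).hasDerivAt.comp s ((hasDerivAt_id s).mul_const x)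
    exact (h1.const_mul (x ^ n)).congr_deriv (by ring)

/-- Differentiation raises the weight and replaces `φ` by its derivative, so the family of all such
means is closed under it; hence the induction is over all `n` and `φ` at once. -/
theorem contDiff_dilationMean (n : ℕ) {φ : ℝ → ℝ} (hφ : ContDiff ℝ ∞ φ) :
    ContDiff ℝ ∞ (dilationMean n φ) := by
  refine contDiff_infty.2 fun k => ?_
  induction k generalizing n φ with
  | zero =>
    exact contDiff_zero.2 (continuous_iff_continuousAt.2 fun t =>
      (hasDerivAt_dilationMean n hφ t).continuousAt)
  | succ k ih =>
    push_cast
    refine contDiff_succ_iff_deriv.2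
      ⟨fun t => (hasDerivAt_dilationMean n hφ t).differentiableAt, by simp, ?_⟩
    rw [show deriv (dilationMean n φ) = dilationMean (n + 1) (deriv φ) from
      funext fun t => (hasDerivAt_dilationMean n hφ t).deriv]
    exact ih (n + 1) (contDiff_infty_iff_deriv.1 hφ).2

/-- Hadamard's lemma in one variable. -/
theorem exists_eq_add_mul {f : ℝ → ℝ} (hf : ContDiff ℝ ∞ f) :
    ∃ g, ContDiff ℝ ∞ g ∧ ∀ t, f t = f 0 + t * g t := by
  have hf' : ContDiff ℝ ∞ (deriv f) := (contDiff_infty_iff_deriv.1 hf).2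
  refine ⟨dilationMean 0 (deriv f), contDiff_dilationMean 0 hf', fun t => ?_⟩
  have h : ∫ x in (0 : ℝ)..1, t * deriv f (t * x) = f (t * 1) - f (t * 0) := by
    refine intervalIntegral.integral_eq_sub_of_hasDerivAt (f := fun x => f (t * x))
      (fun x _ => ?_) ?_
    · exact (((hf.differentiable (by simp)) (t * x)).hasDerivAt.comp x
        ((hasDerivAt_id x).const_mul t)).congr_deriv (by ring)
    · have := hf'.continuous
      exact (by fun_prop : Continuous _).intervalIntegrable _ _
  rw [intervalIntegral.integral_const_mul] at h
  simp only [mul_one, mul_zero] at h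
  simp only [dilationMean, pow_zero, one_mul, h]
  ring

theorem iteratedDeriv_pow_mul_eq_zero {n k : ℕ} (hk : k < n) {g : ℝ → ℝ}
    (hg : ContDiff ℝ ∞ g) : iteratedDeriv k (fun t => t ^ n * g t) 0 = 0 := by
  induction k generalizing n g with
  | zero => simp [hk.ne']
  | succ k ih =>
    obtain ⟨m, rfl⟩ : ∃ m, n = m + 1 := ⟨n - 1, by omega⟩
    rw [iteratedDeriv_succ']
    have : deriv (fun t => t ^ (m + 1) * g t) =
        fun t => t ^ m * ((m + 1) * g t + t * deriv g t) := by
      ext t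
      have h := (hasDerivAt_pow (m + 1) t).mul
        ((hg.differentiable (by simp)) t).hasDerivAt
      refine (h.deriv).trans ?_
      simp only [Nat.add_sub_cancel]
      push_cast
      ring
    rw [this]
    refine ih (by omega) ?_
    have := (contDiff_infty_iff_deriv.1 hg).2
    fun_prop

theorem iteratedDeriv_sum_add_pow_mul {n k : ℕ} (hk : k < n) (c : ℕ → ℝ) {g : ℝ → ℝ}
    (hg : ContDiff ℝ ∞ g) :
    iteratedDeriv k (fun t => ∑ i ∈ Finset.range n, c i * t ^ i + t ^ n * g t) 0 =
      c k * k.factorial := by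
  have hg' : ContDiff ℝ k g := contDiff_infty.1 hg k
  rw [iteratedDeriv_fun_add (by fun_prop) (by fun_prop),
    iteratedDeriv_pow_mul_eq_zero hk hg, add_zero, iteratedDeriv_fun_sum (by fun_prop)]
  simp only [iteratedDeriv_const_mul_field, iteratedDeriv_fun_pow_zero]
  simp [hk]

/-- Taylor's formula with a smooth remainder factor. -/
theorem exists_eq_taylor {f : ℝ → ℝ} (hf : ContDiff ℝ ∞ f) (n : ℕ) :
    ∃ g, ContDiff ℝ ∞ g ∧ ∀ t, f t =
      ∑ i ∈ Finset.range n, iteratedDeriv i f 0 / i.factorial * t ^ i + t ^ n * g t := by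
  obtain ⟨c, g, hg, h⟩ : ∃ (c : ℕ → ℝ) (g : ℝ → ℝ), ContDiff ℝ ∞ g ∧
      ∀ t, f t = ∑ i ∈ Finset.range n, c i * t ^ i + t ^ n * g t := by
    induction n with
    | zero => exact ⟨0, f, hf, by simp⟩
    | succ n ih =>
      obtain ⟨c, g, hg, h⟩ := ih
      obtain ⟨g', hg', h'⟩ := exists_eq_add_mul hg
      refine ⟨Function.update c n (g 0), g', hg', fun t => ?_⟩
      rw [h t, h' t, Finset.sum_range_succ, Function.update_self, Finset.sum_congr rfl
        (f := fun i => Function.update c n (g 0) i * t ^ i) (g := fun i => c i * t ^ i)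
        (fun i hi => by
          simp only [Function.update_of_ne (Finset.mem_range.1 hi).ne])]
      ring
  refine ⟨g, hg, fun t => (h t).trans ?_⟩
  congr 1
  refine Finset.sum_congr rfl fun i hi => ?_
  rw [funext h, iteratedDeriv_sum_add_pow_mul (Finset.mem_range.1 hi) c hg]
  field_simp

theorem exists_eq_pow_mul_of_iteratedDeriv_eq_zero {f : ℝ → ℝ} (hf : ContDiff ℝ ∞ f) {n : ℕ}
    (h : ∀ k < n, iteratedDeriv k f 0 = 0) : ∃ g, ContDiff ℝ ∞ g ∧ ∀ t, f t = t ^ n * g t := by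
  obtain ⟨g, hg, hfg⟩ := exists_eq_taylor hf n
  refine ⟨g, hg, fun t => (hfg t).trans ?_⟩
  rw [Finset.sum_eq_zero fun i hi => by simp [h i (Finset.mem_range.1 hi)], zero_add]

theorem exists_eq_add_pow_succ_mul_of_deriv {u v : ℝ → ℝ} {n : ℕ} (hv : ContDiff ℝ ∞ v)
    (hu : ∀ t, HasDerivAt u (t ^ n * v t) t) :
    ∃ g, ContDiff ℝ ∞ g ∧ ∀ t, u t = u 0 + t ^ (n + 1) * g t := by
  have hd : deriv u = fun t => t ^ n * v t := funext fun t => (hu t).deriv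
  have hu' : ContDiff ℝ ∞ u := by
    refine contDiff_infty_iff_deriv.2 ⟨fun t => (hu t).differentiableAt, ?_⟩
    rw [hd]
    fun_prop
  obtain ⟨g, hg, h⟩ := exists_eq_pow_mul_of_iteratedDeriv_eq_zero (n := n + 1)
    (f := fun t => u t - u 0) (by fun_prop) fun k hk => by
      cases k with
      | zero => simp
      | succ k =>
        rw [iteratedDeriv_succ', funext fun t => deriv_sub_const (f := u) (x := t) (u 0), hd]
        exact iteratedDeriv_pow_mul_eq_zero (by omega) hv
  exact ⟨g, hg, fun t => by rw [← h t]; ring⟩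

/-! ### Borel's lemma -/

/-- A smooth function with prescribed small derivatives which is `a * t ^ n` near `0`. -/
theorem exists_cutoff_monomial (n : ℕ) (a : ℝ) :
    ∃ f : ℝ → ℝ, ContDiff ℝ ∞ f ∧ (f =ᶠ[𝓝 0] fun t => a * t ^ n) ∧
      (∀ k < n, ∀ t, ‖iteratedDeriv k f t‖ ≤ (1 / 2) ^ n) ∧
      ∀ k, ∃ C, ∀ t, ‖iteratedDeriv k f t‖ ≤ C := by
  let χ : ContDiffBump (0 : ℝ) := ⟨1, 2, one_pos, one_lt_two⟩
  have hχ : ContDiff ℝ ∞ χ := χ.contDiff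
  let ρ : ℝ → ℝ := fun t => χ t * t ^ n
  have hρ : ContDiff ℝ ∞ ρ := by fun_prop
  have hbd : ∀ k, ∃ C, ∀ t, ‖iteratedDeriv k ρ t‖ ≤ C := fun k => by
    obtain ⟨C, hC⟩ := (χ.hasCompactSupport.mul_right (f' := fun t => t ^ n)
      |>.iteratedFDeriv (𝕜 := ℝ) k).exists_bound_of_continuous
      (hρ.continuous_iteratedFDeriv (by exact_mod_cast le_top))
    exact ⟨C, fun t => by rw [← norm_iteratedFDeriv_eq_norm_iteratedDeriv]; exact hC t⟩
  choose M hM using hbd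
  have hM0 : ∀ k, 0 ≤ M k := fun k => (norm_nonneg _).trans (hM k 0)
  let S := ∑ k ∈ Finset.range n, M k
  have hS : 0 ≤ S := Finset.sum_nonneg fun k _ => hM0 k
  -- Rescaling by `c` keeps the germ `a * t ^ n` but multiplies the `k`-th derivative by `c ^ k / c
  -- ^ n`. For `k < n` this gains at least one factor `c⁻¹`, and `c` is large enough for that factor
  -- to suffice.
  let c : ℝ := 1 + 2 ^ n * |a| * S
  have hc : 1 ≤ c := le_add_of_nonneg_right (by positivity)
  have hc0 : 0 < c := one_pos.trans_le hc
  have hder : ∀ k t, iteratedDeriv k (fun t => a * c⁻¹ ^ n * ρ (c * t)) t =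
      a * c⁻¹ ^ n * (c ^ k * iteratedDeriv k ρ (c * t)) := fun k t => by
    rw [iteratedDeriv_const_mul_field, iteratedDeriv_comp_const_mul (contDiff_infty.1 hρ k)]
  refine ⟨fun t => a * c⁻¹ ^ n * ρ (c * t), by fun_prop, ?_, fun k hk t => ?_, fun k => ?_⟩
  · have h1 : ∀ᶠ s in 𝓝 (0 : ℝ), χ s = 1 := χ.eventuallyEq_one
    have h2 : Tendsto (fun t : ℝ => c * t) (𝓝 0) (𝓝 0) := by
      simpa using (continuous_const_mul c).tendsto 0
    filter_upwards [h2.eventually h1] with t ht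
    simp only [ρ, ht, one_mul]
    rw [mul_assoc, ← mul_pow, inv_mul_cancel_left₀ hc0.ne']
  · rw [hder]
    obtain ⟨m, rfl⟩ : ∃ m, n = k + 1 + m := ⟨n - (k + 1), by omega⟩
    have h1 : M k ≤ S := Finset.single_le_sum (f := M) (fun k _ => hM0 k) (Finset.mem_range.2 hk)
    have h2 : a * c⁻¹ ^ (k + 1 + m) * (c ^ k * iteratedDeriv k ρ (c * t)) =
        c⁻¹ ^ m * (c⁻¹ * (a * iteratedDeriv k ρ (c * t))) := by
      rw [pow_add, pow_succ]
      have : c⁻¹ ^ k * c ^ k = 1 := by rw [← mul_pow, inv_mul_cancel₀ hc0.ne', one_pow]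
      linear_combination a * c⁻¹ * c⁻¹ ^ m * iteratedDeriv k ρ (c * t) * this
    rw [h2, norm_mul, norm_mul, norm_mul]
    have h3 : ‖c⁻¹ ^ m‖ ≤ 1 := by
      rw [Real.norm_of_nonneg (by positivity)]
      exact pow_le_one₀ (by positivity) (inv_le_one_of_one_le₀ hc)
    have h4 : ‖a‖ * ‖iteratedDeriv k ρ (c * t)‖ ≤ |a| * S :=
      mul_le_mul_of_nonneg_left ((hM k _).trans h1) (abs_nonneg a)
    have h5 : ‖c⁻¹‖ * (‖a‖ * ‖iteratedDeriv k ρ (c * t)‖) ≤ (1 / 2) ^ (k + 1 + m) := by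
      rw [Real.norm_of_nonneg (by positivity : 0 ≤ c⁻¹), inv_mul_le_iff₀ hc0]
      refine h4.trans ?_
      have : c * (1 / 2) ^ (k + 1 + m) = (1 / 2) ^ (k + 1 + m) + |a| * S := by
        have h : (2 : ℝ) ^ (k + 1 + m) * (1 / 2) ^ (k + 1 + m) = 1 := by
          rw [← mul_pow]
          norm_num
        simp only [c]
        linear_combination |a| * S * h
      rw [this]
      exact le_add_of_nonneg_left (by positivity)
    calc _ ≤ 1 * (1 / 2 : ℝ) ^ (k + 1 + m) := by
          gcongr
      _ = _ := one_mul _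
  · refine ⟨‖a * c⁻¹ ^ n * c ^ k‖ * M k, fun t => ?_⟩
    rw [hder, ← mul_assoc, norm_mul]
    gcongr
    exact hM k _

/-- **Borel's lemma**: every real sequence is the Taylor sequence of a smooth function. -/
theorem exists_iteratedDeriv_eq (a : ℕ → ℝ) :
    ∃ f : ℝ → ℝ, ContDiff ℝ ∞ f ∧ ∀ k, iteratedDeriv k f 0 = a k * k.factorial := by
  choose F hF hF0 hFle hFbd using fun n => exists_cutoff_monomial n (a n)
  choose K hK using hFbd
  -- The geometric bound holds only for `n > k`; the finitely many other terms need only be bounded.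
  let v : ℕ → ℕ → ℝ := fun k n => if k < n then (1 / 2) ^ n else K n k
  have hv : ∀ k : ℕ, (k : ℕ∞) ≤ ⊤ → Summable (v k) := fun k _ => by
    refine (summable_congr_cofinite ?_).1 (summable_geometric_two)
    rw [Nat.cofinite_eq_atTop]
    filter_upwards [eventually_gt_atTop k] with n hn
    simp [v, hn]
  have hle : ∀ (k n : ℕ) (x : ℝ), (k : ℕ∞) ≤ ⊤ → ‖iteratedFDeriv ℝ k (F n) x‖ ≤ v k n :=
    fun k n x _ => by
      rw [norm_iteratedFDeriv_eq_norm_iteratedDeriv]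
      by_cases h : k < n
      · simpa only [v, h, if_true] using hFle n k h x
      · simpa only [v, h, if_false] using hK n k x
  refine ⟨fun x => ∑' n, F n x, contDiff_tsum (N := ⊤) hF hv hle, fun k => ?_⟩
  have hsum : Summable fun n => iteratedFDeriv ℝ k (F n) 0 :=
    (hv k le_top).of_norm_bounded fun n => hle k n 0 le_top
  rw [iteratedDeriv_eq_iteratedFDeriv, iteratedFDeriv_tsum (N := ⊤) hF hv hle le_top,
    ContinuousMultilinearMap.tsum_eval hsum]
  simp only [← iteratedDeriv_eq_iteratedFDeriv]
  rw [tsum_eq_single k fun n hn => by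
    rw [(hF0 n).iteratedDeriv_eq k, iteratedDeriv_const_mul_field, iteratedDeriv_fun_pow_zero,
      if_neg (Ne.symm hn), Nat.cast_zero, mul_zero]]
  rw [(hF0 k).iteratedDeriv_eq k, iteratedDeriv_const_mul_field, iteratedDeriv_fun_pow_zero,
      if_pos rfl]

/-! ### Flat functions and the fifth root -/

/-- `R` is smooth and vanishes to infinite order at `0`. -/
def IsFlatAtZero (R : ℝ → ℝ) : Prop :=
  ∀ n, ∃ g, ContDiff ℝ ∞ g ∧ ∀ t, R t = t ^ n * g t

namespace IsFlatAtZero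

variable {R : ℝ → ℝ}

theorem contDiff (h : IsFlatAtZero R) : ContDiff ℝ ∞ R := by
  obtain ⟨g, hg, hR⟩ := h 0
  simpa [funext hR] using hg

theorem pow_mul (h : IsFlatAtZero R) (m : ℕ) : IsFlatAtZero fun t => t ^ m * R t := fun n => by
  obtain ⟨g, hg, hR⟩ := h n
  exact ⟨fun t => t ^ m * g t, by fun_prop, fun t => by simp only [hR]; ring⟩

theorem deriv (h : IsFlatAtZero R) : IsFlatAtZero (deriv R) := fun n => by
  obtain ⟨g, hg, hR⟩ := h (n + 1)
  have hg' := (contDiff_infty_iff_deriv.1 hg).2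
  refine ⟨fun t => (n + 1) * g t + t * _root_.deriv g t, by fun_prop, fun t => ?_⟩
  rw [funext hR]
  refine ((hasDerivAt_pow (n + 1) t).mul (hg.differentiable (by simp) t).hasDerivAt).deriv.trans ?_
  simp only [Nat.add_sub_cancel]
  push_cast
  ring

/-- The quotient is again flat: cancel `t ^ m` in the factorization of order `m + n` away from 0,
then extend to 0 by continuity. -/
theorem exists_eq_pow_mul (h : IsFlatAtZero R) (m : ℕ) :
    ∃ S, IsFlatAtZero S ∧ ∀ t, R t = t ^ m * S t := by
  obtain ⟨S, hS, hR⟩ := h m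
  refine ⟨S, fun n => ?_, hR⟩
  obtain ⟨g, hg, hR'⟩ := h (m + n)
  refine ⟨g, hg, fun t => ?_⟩
  have hc := hS.continuous
  have hc' := hg.continuous
  refine congrFun (Continuous.ext_on (dense_compl_singleton (0 : ℝ)) hc
    (g := fun t => t ^ n * g t) (by fun_prop) fun s hs => ?_) t
  have := (hR s).symm.trans (hR' s)
  rw [pow_add, mul_assoc] at this
  exact mul_left_cancel₀ (pow_ne_zero m hs) this

end IsFlatAtZero

/-- The real fifth root, as the inverse of the increasing bijection `t ↦ t ^ 5`. -/
noncomputable def fifthPowIso : ℝ ≃o ℝ :=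
  StrictMono.orderIsoOfSurjective (fun t : ℝ => t ^ 5) (Odd.strictMono_pow (by decide))
    ((continuous_pow 5).surjective (tendsto_pow_atTop (by decide))
      (((tendsto_neg_atTop_atBot.comp ((tendsto_pow_atTop (n := 5) (by decide)).comp
        tendsto_neg_atBot_atTop)).congr fun x => by
          simp only [Function.comp_apply]
          ring)))

theorem fifthPowIso_symm_pow (x : ℝ) : fifthPowIso.symm x ^ 5 = x :=
  fifthPowIso.apply_symm_apply x

theorem fifthPowIso_symm_apply_pow (t : ℝ) : fifthPowIso.symm (t ^ 5) = t :=
  fifthPowIso.symm_apply_apply t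

theorem continuous_fifthPowIso_symm : Continuous fifthPowIso.symm :=
  fifthPowIso.symm.continuous

/-- Away from 0 the chain rule gives `R' s / (5 * s ^ 4)` at the root `s`. Flatness of `R'` absorbs
the denominator, and the continuous extension of this derivative is the derivative at 0. Since `S`
is again flat, the step can be iterated. -/
theorem IsFlatAtZero.exists_hasDerivAt_comp_root {R : ℝ → ℝ} (hR : IsFlatAtZero R) :
    ∃ S, IsFlatAtZero S ∧
      ∀ x, HasDerivAt (fun x => R (fifthPowIso.symm x)) (S (fifthPowIso.symm x)) x := by
  obtain ⟨S, hS, h⟩ := hR.deriv.exists_eq_pow_mul 4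
  have hS' : IsFlatAtZero fun t => S t / 5 := fun n => by
    obtain ⟨g, hg, hSg⟩ := hS n
    exact ⟨fun t => g t / 5, by fun_prop, fun t => by simp only [hSg]; ring⟩
  have hc := continuous_fifthPowIso_symm
  refine ⟨_, hS', hasDerivAt_of_hasDerivAt_of_ne' (x := 0) (fun y hy => ?_)
    (hR.contDiff.continuous.comp hc).continuousAt
    (hS'.contDiff.continuous.comp hc).continuousAt⟩
  set s := fifthPowIso.symm y with hs
  have hs0 : s ≠ 0 := fun h0 => hy (by rw [← fifthPowIso_symm_pow y, ← hs, h0]; simp)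
  have h1 : HasDerivAt fifthPowIso.symm (5 * s ^ 4)⁻¹ y := by
    refine HasDerivAt.of_local_left_inverse (f := fun t : ℝ => t ^ 5) hc.continuousAt ?_
      (by positivity) (Eventually.of_forall fifthPowIso_symm_pow)
    simpa using hasDerivAt_pow 5 s
  refine (((hR.contDiff.differentiable (by simp)) s).hasDerivAt.comp y h1).congr_deriv ?_
  rw [h]
  field_simp

/-- A flat function is a smooth function of `t ^ 5`. -/
theorem IsFlatAtZero.contDiff_comp_root {R : ℝ → ℝ} (hR : IsFlatAtZero R) :
    ContDiff ℝ ∞ fun x => R (fifthPowIso.symm x) := by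
  refine contDiff_infty.2 fun k => ?_
  induction k generalizing R with
  | zero => exact contDiff_zero.2 (hR.contDiff.continuous.comp continuous_fifthPowIso_symm)
  | succ k ih =>
    obtain ⟨S, hS, h⟩ := hR.exists_hasDerivAt_comp_root
    push_cast
    refine contDiff_succ_iff_deriv.2 ⟨fun x => (h x).differentiableAt, by simp, ?_⟩
    rw [funext fun x => (h x).deriv]
    exact ih hS

/-! ### Factorization through the cusp -/

/-- Up to a flat function, a smooth function is a combination of `1, t, t ^ 2, t ^ 3` with
coefficients that are smooth functions of `t ^ 4`. -/
theorem exists_eq_sum_comp_pow_four {g : ℝ → ℝ} (hg : ContDiff ℝ ∞ g) :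
    ∃ b₀ b₁ b₂ b₃ R : ℝ → ℝ, ContDiff ℝ ∞ b₀ ∧ ContDiff ℝ ∞ b₁ ∧ ContDiff ℝ ∞ b₂ ∧
      ContDiff ℝ ∞ b₃ ∧ IsFlatAtZero R ∧
      ∀ t, g t = b₀ (t ^ 4) + t * b₁ (t ^ 4) + t ^ 2 * b₂ (t ^ 4) + t ^ 3 * b₃ (t ^ 4) + R t := by
  let a : ℕ → ℝ := fun i => iteratedDeriv i g 0 / i.factorial
  -- Borel's lemma, once for each residue class of exponents modulo 4.
  choose b hb hba using fun j : ℕ => exists_iteratedDeriv_eq fun k => a (4 * k + j)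
  refine ⟨b 0, b 1, b 2, b 3, fun t => g t - (b 0 (t ^ 4) + t * b 1 (t ^ 4) +
    t ^ 2 * b 2 (t ^ 4) + t ^ 3 * b 3 (t ^ 4)), hb 0, hb 1, hb 2, hb 3, fun n => ?_,
    fun t => by ring⟩
  have hT : ∀ j, ∃ h, ContDiff ℝ ∞ h ∧ ∀ x, b j x =
      ∑ i ∈ Finset.range n, a (4 * i + j) * x ^ i + x ^ n * h x := fun j => by
    obtain ⟨h, hh, e⟩ := exists_eq_taylor (hb j) n
    refine ⟨h, hh, fun x => (e x).trans ?_⟩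
    congr 1
    refine Finset.sum_congr rfl fun i _ => ?_
    rw [hba]
    field_simp
  choose h hh hbh using hT
  obtain ⟨r, hr, e⟩ := exists_eq_taylor hg (4 * n)
  have hpoly : ∀ t : ℝ, ∑ i ∈ Finset.range (4 * n), a i * t ^ i =
      ∑ i ∈ Finset.range n, a (4 * i + 0) * (t ^ 4) ^ i +
      t * ∑ i ∈ Finset.range n, a (4 * i + 1) * (t ^ 4) ^ i +
      t ^ 2 * ∑ i ∈ Finset.range n, a (4 * i + 2) * (t ^ 4) ^ i +
      t ^ 3 * ∑ i ∈ Finset.range n, a (4 * i + 3) * (t ^ 4) ^ i := fun t => by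
    clear e hbh hba
    induction n with
    | zero => simp
    | succ n ih =>
      rw [show 4 * (n + 1) = 4 * n + 1 + 1 + 1 + 1 by ring]
      simp only [Finset.sum_range_succ, add_zero] at ih ⊢
      linear_combination ih
  have h0 := hh 0
  have h1 := hh 1
  have h2 := hh 2
  have h3 := hh 3
  refine ⟨fun t => t ^ (3 * n) * (r t - (h 0 (t ^ 4) + t * h 1 (t ^ 4) + t ^ 2 * h 2 (t ^ 4) +
    t ^ 3 * h 3 (t ^ 4))), by fun_prop, fun t => ?_⟩
  beta_reduce
  rw [e t, hpoly t, hbh 0, hbh 1, hbh 2, hbh 3]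
  ring

/-- A smooth function whose Taylor coefficients vanish at the gaps `1, 2, 3, 6, 7, 11` of the
semigroup generated by `4` and `5` is a smooth function of `(t ^ 4, t ^ 5)`. -/
theorem exists_factor_through_cusp {f g : ℝ → ℝ} (c₀ c₄ c₅ c₈ c₉ c₁₀ : ℝ) (hg : ContDiff ℝ ∞ g)
    (hf : ∀ t, f t = c₀ + c₄ * t ^ 4 + c₅ * t ^ 5 + c₈ * t ^ 8 + c₉ * t ^ 9 + c₁₀ * t ^ 10 +
      t ^ 12 * g t) :
    ∃ U V : ℝ × ℝ → ℝ, ContDiff ℝ ∞ U ∧ ContDiff ℝ ∞ V ∧ U 0 = 0 ∧ V 0 = 0 ∧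
      ∀ t, f t = c₀ + t ^ 4 * (c₄ + U (t ^ 4, t ^ 5)) + t ^ 5 * (c₅ + V (t ^ 4, t ^ 5)) := by
  obtain ⟨b₀, b₁, b₂, b₃, R, h₀, h₁, h₂, h₃, hR, h⟩ := exists_eq_sum_comp_pow_four hg
  have hS := (hR.pow_mul 7).contDiff_comp_root
  -- The exponents 12, 13, 14, 15 are `4+4+4`, `4+4+5`, `4+5+5`, `5+5+5`, which places `b₀`, …,
  -- `b₃`. The flat part is `t ^ 12 * R t = t ^ 5 * (t ^ 7 * R t)`, whose second factor is smooth in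
  -- `t ^ 5`.
  refine ⟨fun z => c₈ * z.1 + z.1 ^ 2 * b₀ z.1 + z.1 * z.2 * b₁ z.1 + z.2 ^ 2 * b₂ z.1,
    fun z => c₉ * z.1 + c₁₀ * z.2 + z.2 ^ 2 * b₃ z.1 +
      fifthPowIso.symm z.2 ^ 7 * R (fifthPowIso.symm z.2), by fun_prop, ?_, by simp, ?_,
    fun t => ?_⟩
  · have := hS.comp (contDiff_snd (E := ℝ) (F := ℝ))
    exact ContDiff.add (by fun_prop) this
  · have h0 : fifthPowIso.symm 0 = 0 := by simpa using fifthPowIso_symm_apply_pow 0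
    simp [h0]
  · simp only [fifthPowIso_symm_apply_pow]
    rw [hf, h]
    ring

/-! ### Germs of diffeomorphisms -/

/-- A function that is smooth near a point agrees near that point with a smooth function. -/
theorem exists_contDiff_eventuallyEq {E F : Type*} [NormedAddCommGroup E] [NormedSpace ℝ E]
    [NormedAddCommGroup F] [NormedSpace ℝ F] [HasContDiffBump E] {f : E → F} {s : Set E} {p : E}
    (hs : s ∈ 𝓝 p) (hf : ContDiffOn ℝ ∞ f s) : ∃ g, ContDiff ℝ ∞ g ∧ g =ᶠ[𝓝 p] f := by
  obtain ⟨ε, hε, hsub⟩ := Metric.mem_nhds_iff.1 hs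
  let χ : ContDiffBump p := ⟨ε / 3, ε / 2, by positivity, by linarith⟩
  refine ⟨fun x => χ x • f x, contDiff_iff_contDiffAt.2 fun x => ?_, ?_⟩
  · by_cases hx : x ∈ Metric.ball p ε
    · exact χ.contDiff.contDiffAt.smul
        (hf.contDiffAt (mem_of_superset (Metric.isOpen_ball.mem_nhds hx) hsub))
    · have h0 : ∀ᶠ y in 𝓝 x, χ y = 0 := by
        have : x ∉ tsupport χ := fun h => hx <| by
          rw [χ.tsupport_eq] at h
          exact Metric.closedBall_subset_ball (by simp only [χ]; linarith) h
        exact notMem_tsupport_iff_eventuallyEq.1 this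
      refine (contDiffAt_const (c := (0 : F))).congr_of_eventuallyEq ?_
      filter_upwards [h0] with y hy
      simp [hy]
  · filter_upwards [χ.eventuallyEq_one] with x hx
    simp [hx]

/-- The inverse function theorem, for germs of diffeomorphisms. -/
theorem exists_isDiffeoGerm {E F : Type*} [NormedAddCommGroup E] [NormedSpace ℝ E]
    [CompleteSpace E] [NormedAddCommGroup F] [NormedSpace ℝ F] {f : E → F} (hf : ContDiff ℝ ∞ f)
    {p : E} (L : E ≃L[ℝ] F) (hL : HasFDerivAt f (L : E →L[ℝ] F) p) :
    ∃ φ : OpenPartialHomeomorph E F, IsDiffeoGerm ∞ φ p (f p) ∧ ∀ x, φ x = f x := by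
  -- On this open set the derivative is invertible, so after restriction the inverse is smooth on
  -- the whole target.
  let U : Set E := fderiv ℝ f ⁻¹' range ((↑) : (E ≃L[ℝ] F) → E →L[ℝ] F)
  have hU : IsOpen U := ContinuousLinearEquiv.isOpen.preimage (hf.continuous_fderiv (by simp))
  let φ := (hf.contDiffAt (x := p)).toOpenPartialHomeomorph f hL (by simp)
  have hp : p ∈ φ.source := hf.contDiffAt.mem_toOpenPartialHomeomorph_source hL (by simp)
  refine ⟨φ.restrOpen U hU, ⟨⟨hp, L, hL.fderiv.symm⟩, rfl, hf.contDiffOn, fun y hy => ?_⟩,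
    fun x => rfl⟩
  have hmem := (φ.restrOpen U hU).map_target hy
  obtain ⟨L', hL'⟩ := hmem.2
  refine (OpenPartialHomeomorph.contDiffAt_symm _ (f₀' := L') hy ?_
    hf.contDiffAt).contDiffWithinAt
  rw [hL']
  exact (hf.differentiable (by simp) _).hasFDerivAt

/-- The linear map of the plane with columns `u` and `v`. -/
noncomputable def planeLinearMap (u v : ℝ × ℝ) : ℝ × ℝ →L[ℝ] ℝ × ℝ :=
  (ContinuousLinearMap.fst ℝ ℝ ℝ).smulRight u + (ContinuousLinearMap.snd ℝ ℝ ℝ).smulRight v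

theorem exists_equiv_planeLinearMap {u v : ℝ × ℝ} (h : planeDet u v ≠ 0) :
    ∃ L : (ℝ × ℝ) ≃L[ℝ] ℝ × ℝ, (L : ℝ × ℝ →L[ℝ] ℝ × ℝ) = planeLinearMap u v := by
  simp only [planeDet, Matrix.det_fin_two_of] at h
  set d := u.1 * v.2 - v.1 * u.2 with hd
  refine ⟨ContinuousLinearEquiv.equivOfInverse (planeLinearMap u v)
    (planeLinearMap (v.2 / d, -u.2 / d) (-v.1 / d, u.1 / d)) (fun z => ?_) fun z => ?_, rfl⟩
  all_goals
    ext <;> simp [planeLinearMap] <;> field_simp <;> rw [hd] <;> ring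

theorem planeDet_ne_zero_of_equiv (L : (ℝ × ℝ) ≃L[ℝ] ℝ × ℝ) :
    planeDet (L (1, 0)) (L (0, 1)) ≠ 0 := fun h => by
  simp only [planeDet, Matrix.det_fin_two_of] at h
  set u := L (1, 0) with hu
  set v := L (0, 1) with hv
  have key : ∀ x y : ℝ, L (x, y) = x • u + y • v := fun x y => by
    rw [hu, hv, ← map_smul, ← map_smul, ← map_add]
    simp
  have h1 : L (v.2, -u.2) = 0 := by
    rw [key]
    ext <;> simp <;> linarith
  have h2 : L (v.1, -u.1) = 0 := by
    rw [key]
    ext <;> simp <;> linarith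
  have h1' := L.map_eq_zero_iff.1 h1
  have h2' := L.map_eq_zero_iff.1 h2
  simp only [Prod.mk_eq_zero, neg_eq_zero] at h1' h2'
  have : u = 0 := Prod.ext h2'.2 h1'.2
  have := L.map_eq_zero_iff.1 (hu.symm.trans this)
  simp at this

theorem iteratedDeriv_prodMk {f g : ℝ → ℝ} (hf : ContDiff ℝ ∞ f) (hg : ContDiff ℝ ∞ g) (k : ℕ)
    (t : ℝ) :
    iteratedDeriv k (fun t => (f t, g t)) t = (iteratedDeriv k f t, iteratedDeriv k g t) := by
  induction k generalizing f g with
  | zero => simp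
  | succ k ih =>
    have : deriv (fun t => (f t, g t)) = fun t => (deriv f t, deriv g t) := funext fun t =>
      ((hf.differentiable (by simp) t).hasDerivAt.prodMk
        (hg.differentiable (by simp) t).hasDerivAt).deriv
    rw [iteratedDeriv_succ', iteratedDeriv_succ', iteratedDeriv_succ', this]
    exact ih (contDiff_infty_iff_deriv.1 hf).2 (contDiff_infty_iff_deriv.1 hg).2

namespace IsDiffeoGerm

variable {E F : Type*} [NormedAddCommGroup E] [NormedSpace ℝ E] [NormedAddCommGroup F]
  [NormedSpace ℝ F] {r : WithTop ℕ∞} {φ : OpenPartialHomeomorph E F} {p : E} {q : F}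

theorem mem_target (h : IsDiffeoGerm r φ p q) : q ∈ φ.target :=
  h.map_eq ▸ φ.map_source h.mem_source

theorem symm_apply (h : IsDiffeoGerm r φ p q) : φ.symm q = p :=
  h.map_eq ▸ φ.left_inv h.mem_source

protected theorem symm (h : IsDiffeoGerm r φ p q) : IsDiffeoGerm r φ.symm q p :=
  ⟨h.mem_target, h.symm_apply, h.contDiffOn_symm, h.contDiffOn⟩

/-- The chain rule applied to both composites of `φ` and `φ.symm` makes their derivatives mutually
inverse. -/
theorem exists_hasFDerivAt (h : IsDiffeoGerm ∞ φ p q) :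
    ∃ L : E ≃L[ℝ] F, HasFDerivAt φ (L : E →L[ℝ] F) p := by
  have h1 : HasFDerivAt φ (fderiv ℝ φ p) p :=
    ((h.contDiffOn.contDiffAt (φ.open_source.mem_nhds h.mem_source)).differentiableAt
      (by simp)).hasFDerivAt
  have h2 : HasFDerivAt φ.symm (fderiv ℝ φ.symm q) q :=
    ((h.contDiffOn_symm.contDiffAt (φ.open_target.mem_nhds h.mem_target)).differentiableAt
      (by simp)).hasFDerivAt
  have h3 : (fderiv ℝ φ.symm q).comp (fderiv ℝ φ p) = ContinuousLinearMap.id ℝ E :=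
    ((HasFDerivAt.comp p (g := φ.symm) (by rwa [h.map_eq]) h1).congr_of_eventuallyEq
      (f₁ := id) (by
        filter_upwards [φ.open_source.mem_nhds h.mem_source] with x hx
        exact (φ.left_inv hx).symm)).unique (hasFDerivAt_id p)
  have h4 : (fderiv ℝ φ p).comp (fderiv ℝ φ.symm q) = ContinuousLinearMap.id ℝ F :=
    ((HasFDerivAt.comp q (g := φ) (by rwa [h.symm_apply]) h2).congr_of_eventuallyEq
      (f₁ := id) (by
        filter_upwards [φ.open_target.mem_nhds h.mem_target] with x hx
        exact (φ.right_inv hx).symm)).unique (hasFDerivAt_id q)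
  exact ⟨ContinuousLinearEquiv.equivOfInverse (fderiv ℝ φ p) (fderiv ℝ φ.symm q)
    (fun x => DFunLike.congr_fun h3 x) (fun x => DFunLike.congr_fun h4 x), h1⟩

end IsDiffeoGerm

/-! ### Jets and their composition -/

/-- `f` is `c₀ + c₁ t + c₂ t² + c₃ t³` up to a smooth multiple of `t⁴`. -/
def HasCubicJet (f : ℝ → ℝ) (c₀ c₁ c₂ c₃ : ℝ) : Prop :=
  ∃ g, ContDiff ℝ ∞ g ∧ ∀ t, f t = c₀ + c₁ * t + c₂ * t ^ 2 + c₃ * t ^ 3 + t ^ 4 * g t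

theorem HasCubicJet.mul {f g : ℝ → ℝ} {a₀ a₁ a₂ a₃ b₀ b₁ b₂ b₃ : ℝ}
    (hf : HasCubicJet f a₀ a₁ a₂ a₃) (hg : HasCubicJet g b₀ b₁ b₂ b₃) :
    HasCubicJet (fun t => f t * g t) (a₀ * b₀) (a₀ * b₁ + a₁ * b₀)
      (a₀ * b₂ + a₁ * b₁ + a₂ * b₀) (a₀ * b₃ + a₁ * b₂ + a₂ * b₁ + a₃ * b₀) := by
  obtain ⟨u, hu, hfu⟩ := hf
  obtain ⟨v, hv, hgv⟩ := hg
  refine ⟨fun t => a₁ * b₃ + a₂ * b₂ + a₃ * b₁ + (a₂ * b₃ + a₃ * b₂) * t + a₃ * b₃ * t ^ 2 +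
    (a₀ + a₁ * t + a₂ * t ^ 2 + a₃ * t ^ 3) * v t +
    (b₀ + b₁ * t + b₂ * t ^ 2 + b₃ * t ^ 3) * u t + t ^ 4 * u t * v t, by fun_prop, fun t => ?_⟩
  simp only [hfu, hgv]
  ring

theorem HasCubicJet.const_add {f : ℝ → ℝ} {a₀ a₁ a₂ a₃ : ℝ} (hf : HasCubicJet f a₀ a₁ a₂ a₃)
    (b : ℝ) : HasCubicJet (fun t => b + f t) (b + a₀) a₁ a₂ a₃ := by
  obtain ⟨u, hu, hfu⟩ := hf
  exact ⟨u, hu, fun t => by simp only [hfu]; ring⟩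

theorem HasCubicJet.id_mul {f : ℝ → ℝ} {a₀ a₁ a₂ a₃ : ℝ} (hf : HasCubicJet f a₀ a₁ a₂ a₃) :
    HasCubicJet (fun t => t * f t) 0 a₀ a₁ a₂ := by
  obtain ⟨u, hu, hfu⟩ := hf
  exact ⟨fun t => a₃ + t * u t, by fun_prop, fun t => by simp only [hfu]; ring⟩

theorem HasCubicJet.contDiff {f : ℝ → ℝ} {a₀ a₁ a₂ a₃ : ℝ} (hf : HasCubicJet f a₀ a₁ a₂ a₃) :
    ContDiff ℝ ∞ f := by
  obtain ⟨u, hu, hfu⟩ := hf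
  rw [funext hfu]
  fun_prop

theorem hasCubicJet_const (b : ℝ) : HasCubicJet (fun _ => b) b 0 0 0 :=
  ⟨fun _ => 0, contDiff_const, fun t => by ring⟩

theorem exists_hasCubicJet {f : ℝ → ℝ} (hf : ContDiff ℝ ∞ f) :
    ∃ c₁ c₂ c₃, HasCubicJet f (f 0) c₁ c₂ c₃ := by
  obtain ⟨g, hg, h⟩ := exists_eq_taylor hf 4
  refine ⟨iteratedDeriv 1 f 0 / (1 : ℕ).factorial, iteratedDeriv 2 f 0 / (2 : ℕ).factorial,
    iteratedDeriv 3 f 0 / (3 : ℕ).factorial, g, hg, fun t => (h t).trans ?_⟩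
  simp only [Finset.sum_range_succ, Finset.sum_range_zero, iteratedDeriv_zero, pow_zero, pow_one,
    Nat.factorial_zero, Nat.cast_one, div_one, mul_one, zero_add]

/-- `f` is `c + c₄ t⁴ + c₅ t⁵ + c₆ t⁶ + c₇ t⁷` up to a smooth multiple of `t⁸`. -/
def HasQuarticGerm (f : ℝ → ℝ) (c c₄ c₅ c₆ c₇ : ℝ) : Prop :=
  ∃ g, ContDiff ℝ ∞ g ∧
    ∀ t, f t = c + c₄ * t ^ 4 + c₅ * t ^ 5 + c₆ * t ^ 6 + c₇ * t ^ 7 + t ^ 8 * g t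

theorem hasQuarticGerm_of_iteratedDeriv {f : ℝ → ℝ} (hf : ContDiff ℝ ∞ f)
    (h1 : iteratedDeriv 1 f 0 = 0) (h2 : iteratedDeriv 2 f 0 = 0) (h3 : iteratedDeriv 3 f 0 = 0) :
    HasQuarticGerm f (f 0) (iteratedDeriv 4 f 0 / 24) (iteratedDeriv 5 f 0 / 120)
      (iteratedDeriv 6 f 0 / 720) (iteratedDeriv 7 f 0 / 5040) := by
  obtain ⟨g, hg, h⟩ := exists_eq_taylor hf 8
  refine ⟨g, hg, fun t => (h t).trans ?_⟩
  simp only [Finset.sum_range_succ, Finset.sum_range_zero, iteratedDeriv_zero, h1, h2, h3,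
    Nat.factorial]
  norm_num

theorem HasQuarticGerm.iteratedDeriv_eq {f : ℝ → ℝ} {c c₄ c₅ c₆ c₇ : ℝ}
    (h : HasQuarticGerm f c c₄ c₅ c₆ c₇) :
    iteratedDeriv 1 f 0 = 0 ∧ iteratedDeriv 2 f 0 = 0 ∧ iteratedDeriv 3 f 0 = 0 ∧
      iteratedDeriv 4 f 0 = 24 * c₄ ∧ iteratedDeriv 5 f 0 = 120 * c₅ ∧
      iteratedDeriv 6 f 0 = 720 * c₆ ∧ iteratedDeriv 7 f 0 = 5040 * c₇ := by
  obtain ⟨g, hg, hfg⟩ := h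
  let a : ℕ → ℝ := fun i =>
    match i with
    | 0 => c
    | 4 => c₄
    | 5 => c₅
    | 6 => c₆
    | 7 => c₇
    | _ => 0
  have hf : f = fun t => ∑ i ∈ Finset.range 8, a i * t ^ i + t ^ 8 * g t := funext fun t => by
    rw [hfg]
    simp only [Finset.sum_range_succ, Finset.sum_range_zero, a]
    ring
  have key : ∀ k < 8, iteratedDeriv k f 0 = a k * k.factorial := fun k hk =>
    hf ▸ iteratedDeriv_sum_add_pow_mul hk a hg
  refine ⟨(key 1 (by norm_num)).trans ?_, (key 2 (by norm_num)).trans ?_,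
    (key 3 (by norm_num)).trans ?_, (key 4 (by norm_num)).trans ?_,
    (key 5 (by norm_num)).trans ?_, (key 6 (by norm_num)).trans ?_,
    (key 7 (by norm_num)).trans ?_⟩
  all_goals
    simp only [a, Nat.factorial]
    push_cast
    ring

/-- With `w = s * Q s`, the nonconstant part is `s ^ 4 * Q s ^ 4 * (v₄ + w * (v₅ + w * (v₆ + w *
v₇)))` up to order 8, so the cubic jet of the cofactor of `s ^ 4` suffices; it is built in Horner
form. -/
theorem HasQuarticGerm.comp {f Q : ℝ → ℝ} {c v₄ v₅ v₆ v₇ a₀ a₁ a₂ a₃ : ℝ}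
    (hf : HasQuarticGerm f c v₄ v₅ v₆ v₇) (hQ : HasCubicJet Q a₀ a₁ a₂ a₃) :
    HasQuarticGerm (fun s => f (s * Q s)) c (v₄ * a₀ ^ 4) (v₄ * (4 * a₀ ^ 3 * a₁) + v₅ * a₀ ^ 5)
      (v₄ * (4 * a₀ ^ 3 * a₂ + 6 * a₀ ^ 2 * a₁ ^ 2) + v₅ * (5 * a₀ ^ 4 * a₁) + v₆ * a₀ ^ 6)
      (v₄ * (4 * a₀ ^ 3 * a₃ + 12 * a₀ ^ 2 * a₁ * a₂ + 4 * a₀ * a₁ ^ 3) +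
        v₅ * (5 * a₀ ^ 4 * a₂ + 10 * a₀ ^ 3 * a₁ ^ 2) + v₆ * (6 * a₀ ^ 5 * a₁) + v₇ * a₀ ^ 7) := by
  obtain ⟨g, hg, hfg⟩ := hf
  have hQs := hQ.contDiff
  have hw := hQ.id_mul
  have hQ2 := hQ.mul hQ
  obtain ⟨r, hr, e⟩ := ((((((hw.mul (hasCubicJet_const v₇)).const_add v₆).mul hw).const_add
    v₅).mul hw).const_add v₄).mul (hQ2.mul hQ2)
  refine ⟨fun s => r s + Q s ^ 8 * g (s * Q s), by fun_prop, fun s => ?_⟩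
  simp only [hfg]
  linear_combination s ^ 4 * e s

/-! ### Necessity: the low-order jet of a curve equivalent to the cusp -/

/-- Along `t ↦ (t⁴, t⁵)` a smooth function of the plane is affine up to order `8`. -/
theorem hasQuarticGerm_comp_cusp {F : ℝ × ℝ → ℝ} (hF : ContDiff ℝ ∞ F) :
    HasQuarticGerm (fun s => F (s ^ 4, s ^ 5)) (F 0) (fderiv ℝ F 0 (1, 0))
      (fderiv ℝ F 0 (0, 1)) 0 0 := by
  have hd : ∀ {G : ℝ × ℝ → ℝ}, ContDiff ℝ ∞ G → ∀ s : ℝ,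
      HasDerivAt (fun s : ℝ => G (s ^ 4, s ^ 5))
        (s ^ 3 * (4 * fderiv ℝ G (s ^ 4, s ^ 5) (1, 0) +
          5 * s * fderiv ℝ G (s ^ 4, s ^ 5) (0, 1))) s := fun {G} hG s => by
    refine (((hG.differentiable (by simp)) (s ^ 4, s ^ 5)).hasFDerivAt.comp_hasDerivAt s
      ((hasDerivAt_pow 4 s).prodMk (hasDerivAt_pow 5 s))).congr_deriv ?_
    have : ((((4 : ℕ) : ℝ) * s ^ (4 - 1), ((5 : ℕ) : ℝ) * s ^ (5 - 1)) : ℝ × ℝ) =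
        (4 * s ^ 3) • ((1, 0) : ℝ × ℝ) + (5 * s ^ 4) • ((0, 1) : ℝ × ℝ) := by
      ext <;> simp
    rw [this, map_add, map_smul, map_smul, smul_eq_mul, smul_eq_mul]
    ring
  have hp : ∀ {G : ℝ × ℝ → ℝ}, ContDiff ℝ ∞ G → ∀ v, ContDiff ℝ ∞ fun z => fderiv ℝ G z v :=
    fun hG v => (hG.fderiv_right (m := ∞) (by simp)).clm_apply contDiff_const
  have hc : ∀ {G : ℝ × ℝ → ℝ}, ContDiff ℝ ∞ G → ContDiff ℝ ∞ fun s : ℝ => G (s ^ 4, s ^ 5) :=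
    fun hG => hG.comp (by fun_prop)
  have hexp : ∀ {G : ℝ × ℝ → ℝ}, ContDiff ℝ ∞ G → ∃ g, ContDiff ℝ ∞ g ∧
      ∀ s : ℝ, G (s ^ 4, s ^ 5) = G 0 + s ^ 4 * g s := fun {G} hG => by
    have h1 := hc (hp hG (1, 0))
    have h2 := hc (hp hG (0, 1))
    obtain ⟨g, hg, e⟩ := exists_eq_add_pow_succ_mul_of_deriv (by fun_prop) (hd hG)
    exact ⟨g, hg, fun s => by
      simpa only [ne_eq, OfNat.ofNat_ne_zero, not_false_eq_true, zero_pow, Prod.mk_zero_zero]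
        using e s⟩
  obtain ⟨g₁, hg₁, e₁⟩ := hexp (hp hF (1, 0))
  obtain ⟨g₂, hg₂, e₂⟩ := hexp (hp hF (0, 1))
  set p := fderiv ℝ F 0 (1, 0)
  set q := fderiv ℝ F 0 (0, 1)
  -- Without its linear part, `F` has partial derivatives of order `s ^ 4` along the cusp, and the
  -- velocity of the cusp adds `s ^ 3`: the derivative is divisible by `s ^ 7`.
  obtain ⟨g, hg, e⟩ := exists_eq_add_pow_succ_mul_of_deriv (n := 7)
    (u := fun s : ℝ => F (s ^ 4, s ^ 5) - p * s ^ 4 - q * s ^ 5)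
    (v := fun s => 4 * g₁ s + 5 * s * g₂ s) (by fun_prop) fun s => by
      refine (((hd hF s).sub ((hasDerivAt_pow 4 s).const_mul p)).sub
        ((hasDerivAt_pow 5 s).const_mul q)).congr_deriv ?_
      rw [e₁, e₂]
      push_cast
      ring
  refine ⟨g, hg, fun s => ?_⟩
  have h0 := e s
  simp only [ne_eq, OfNat.ofNat_ne_zero, not_false_eq_true, zero_pow, mul_zero, sub_zero,
    Prod.mk_zero_zero] at h0
  linear_combination h0

theorem exists_hasQuarticGerm_of_aEquivalentAtZero {γ : ℝ → ℝ × ℝ} (hcont : ContinuousAt γ 0)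
    (h : AEquivalentAtZero γ (standardCusp 4 5)) :
    ∃ x₄ x₅ y₄ y₅ a₀ a₁ a₂ a₃ : ℝ, x₄ * y₅ - x₅ * y₄ ≠ 0 ∧ a₀ ≠ 0 ∧
      (∃ f g : ℝ → ℝ, (γ =ᶠ[𝓝 0] fun t => (f t, g t)) ∧ ContDiff ℝ ∞ f ∧ ContDiff ℝ ∞ g ∧
      HasQuarticGerm f (f 0) (x₄ * a₀ ^ 4) (x₄ * (4 * a₀ ^ 3 * a₁) + x₅ * a₀ ^ 5)
        (x₄ * (4 * a₀ ^ 3 * a₂ + 6 * a₀ ^ 2 * a₁ ^ 2) + x₅ * (5 * a₀ ^ 4 * a₁))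
        (x₄ * (4 * a₀ ^ 3 * a₃ + 12 * a₀ ^ 2 * a₁ * a₂ + 4 * a₀ * a₁ ^ 3) +
          x₅ * (5 * a₀ ^ 4 * a₂ + 10 * a₀ ^ 3 * a₁ ^ 2)) ∧
      HasQuarticGerm g (g 0) (y₄ * a₀ ^ 4) (y₄ * (4 * a₀ ^ 3 * a₁) + y₅ * a₀ ^ 5)
        (y₄ * (4 * a₀ ^ 3 * a₂ + 6 * a₀ ^ 2 * a₁ ^ 2) + y₅ * (5 * a₀ ^ 4 * a₁))
        (y₄ * (4 * a₀ ^ 3 * a₃ + 12 * a₀ ^ 2 * a₁ * a₂ + 4 * a₀ * a₁ ^ 3) +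
          y₅ * (5 * a₀ ^ 4 * a₂ + 10 * a₀ ^ 3 * a₁ ^ 2))) := by
  obtain ⟨ψ, Ψ, hψ, hΨ, h⟩ := h
  have hcusp0 : standardCusp 4 5 0 = 0 := by simp [standardCusp]
  rw [hcusp0] at hΨ
  obtain ⟨φ, hφ, hφψ⟩ := exists_contDiff_eventuallyEq
    (ψ.open_source.mem_nhds hψ.mem_source) hψ.contDiffOn
  obtain ⟨Φ, hΦ, hΦΨ⟩ := exists_contDiff_eventuallyEq
    (Ψ.open_target.mem_nhds hΨ.mem_target) hΨ.contDiffOn_symm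
  obtain ⟨L, hL⟩ := hΨ.symm.exists_hasFDerivAt
  obtain ⟨l, hl⟩ := hψ.exists_hasFDerivAt
  have hL' : HasFDerivAt Φ (L : ℝ × ℝ →L[ℝ] ℝ × ℝ) 0 := hL.congr_of_eventuallyEq hΦΨ
  have hl' : HasDerivAt φ (l 1) 0 := (hl.congr_of_eventuallyEq hφψ).hasDerivAt
  have hφ0 : φ 0 = 0 := hφψ.eq_of_nhds.trans hψ.map_eq
  -- `γ` is a smooth map of the plane applied to the cusp, up to a change of parameter
  have hγ : γ =ᶠ[𝓝 0] fun t => Φ (φ t ^ 4, φ t ^ 5) := by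
    have hψc : Tendsto ψ (𝓝 0) (𝓝 0) := by
      have := ψ.continuousAt hψ.mem_source
      rwa [ContinuousAt, hψ.map_eq] at this
    have hγs : ∀ᶠ s in 𝓝 (0 : ℝ), Φ (s ^ 4, s ^ 5) = Ψ.symm (s ^ 4, s ^ 5) := by
      have hc : Tendsto (fun s : ℝ => (s ^ 4, s ^ 5)) (𝓝 0) (𝓝 0) := by
        have : Continuous fun s : ℝ => (s ^ 4, s ^ 5) := by fun_prop
        simpa only [ne_eq, OfNat.ofNat_ne_zero, not_false_eq_true, zero_pow, Prod.mk_zero_zero]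
          using this.tendsto 0
      exact hc.eventually hΦΨ
    -- Continuity of `γ` keeps `γ t` in the source of `Ψ`, where `Ψ` can be inverted.
    filter_upwards [hψc.eventually h, hψc.eventually hγs, hφψ,
      ψ.open_source.mem_nhds hψ.mem_source,
      hcont.preimage_mem_nhds (Ψ.open_source.mem_nhds hΨ.mem_source)] with t h1 h2 h3 h4 h5
    rw [ψ.left_inv h4] at h1
    rw [h3, h2, ← Ψ.left_inv h5, h1, standardCusp]
  have hQ : ∃ Q a₁ a₂ a₃, HasCubicJet Q (l 1) a₁ a₂ a₃ ∧ ∀ t, φ t = t * Q t := by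
    obtain ⟨Q, hQ, e⟩ := exists_eq_add_mul hφ
    obtain ⟨a₁, a₂, a₃, hj⟩ := exists_hasCubicJet hQ
    have e' : ∀ t, φ t = t * Q t := fun t => by rw [e, hφ0, zero_add]
    have : l 1 = Q 0 := by
      refine hl'.unique ?_
      rw [funext e']
      exact ((hasDerivAt_id (0 : ℝ)).mul (hQ.differentiable (by simp) 0).hasDerivAt).congr_deriv
        (by simp)
    exact ⟨Q, a₁, a₂, a₃, this ▸ hj, e'⟩
  obtain ⟨Q, a₁, a₂, a₃, hQ, e⟩ := hQ
  have hF₁ : ContDiff ℝ ∞ fun z => (Φ z).1 := by fun_prop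
  have hF₂ : ContDiff ℝ ∞ fun z => (Φ z).2 := by fun_prop
  have h₁ := (hasQuarticGerm_comp_cusp hF₁).comp hQ
  have h₂ := (hasQuarticGerm_comp_cusp hF₂).comp hQ
  rw [hL'.fst.fderiv] at h₁
  rw [hL'.snd.fderiv] at h₂
  simp only [← e, zero_mul, add_zero, ContinuousLinearMap.comp_apply,
    ContinuousLinearMap.coe_fst', ContinuousLinearMap.coe_snd',
    ContinuousLinearEquiv.coe_coe] at h₁ h₂
  have hz : (φ 0 ^ 4, φ 0 ^ 5) = (0 : ℝ × ℝ) := by simp [hφ0]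
  have hdet := planeDet_ne_zero_of_equiv L
  simp only [planeDet, Matrix.det_fin_two_of] at hdet
  refine ⟨(L (1, 0)).1, (L (0, 1)).1, (L (1, 0)).2, (L (0, 1)).2, l 1, a₁, a₂, a₃, hdet, by simp,
    fun t => (Φ (φ t ^ 4, φ t ^ 5)).1, fun t => (Φ (φ t ^ 4, φ t ^ 5)).2, hγ, by fun_prop,
    by fun_prop, ?_, ?_⟩
  · simpa only [hz] using h₁
  · simpa only [hz] using h₂

/-! ### Sufficiency: removing the gaps 6, 7 and 11 -/

/-- The parameter change `r ↦ r (1 + r⁶ (p + q r))` removes the coefficient of `t¹¹`. -/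
theorem HasQuarticGerm.exists_eq_comp {f : ℝ → ℝ} {c w₄ w₅ : ℝ}
    (hf : HasQuarticGerm f c w₄ w₅ 0 0) :
    ∃ e : ℝ, ∀ p q : ℝ, e + 4 * q * w₄ + 5 * p * w₅ = 0 →
      ∃ U V : ℝ × ℝ → ℝ, ContDiff ℝ ∞ U ∧ ContDiff ℝ ∞ V ∧ U 0 = 0 ∧ V 0 = 0 ∧
        ∀ r, f (r * (1 + r ^ 6 * (p + q * r))) =
          c + r ^ 4 * (w₄ + U (r ^ 4, r ^ 5)) + r ^ 5 * (w₅ + V (r ^ 4, r ^ 5)) := by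
  obtain ⟨g, hg, hfg⟩ := hf
  obtain ⟨e₁, e₂, e₃, h, hh, hgh⟩ := exists_hasCubicJet hg
  refine ⟨e₃, fun p q hpq => ?_⟩
  -- The terms of orders 8 to 11 are thus altered only from order 14 on. Below order 12 the
  -- parameter change adds just `4 * p * w₄` at order 10, which is not a gap, and `4 * q * w₄ + 5 *
  -- p * w₅` at order 11.
  have hpow : ∀ n : ℕ, ∃ T : ℝ → ℝ, ContDiff ℝ ∞ T ∧ ∀ r : ℝ,
      (1 + r ^ 6 * (p + q * r)) ^ n = 1 + r ^ 6 * T r := fun n => by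
    induction n with
    | zero => exact ⟨fun _ => 0, contDiff_const, by simp⟩
    | succ n ih =>
      obtain ⟨T, hT, e⟩ := ih
      exact ⟨fun r => T r + (1 + r ^ 6 * T r) * (p + q * r), by fun_prop, fun r => by
        rw [pow_succ, e]; ring⟩
  obtain ⟨T₈, h₈, t₈⟩ := hpow 8
  obtain ⟨T₉, h₉, t₉⟩ := hpow 9
  obtain ⟨T₁₀, h₁₀, t₁₀⟩ := hpow 10
  obtain ⟨T₁₁, h₁₁, t₁₁⟩ := hpow 11
  refine exists_factor_through_cusp (f := fun r => f (r * (1 + r ^ 6 * (p + q * r)))) c w₄ w₅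
    (g 0) e₁ (e₂ + 4 * p * w₄) (g := fun r =>
      w₄ * (p + q * r) ^ 2 * (6 * r ^ 4 + 4 * r ^ 10 * (p + q * r) +
        r ^ 16 * (p + q * r) ^ 2) + w₅ * (5 * q + (p + q * r) ^ 2 * (10 * r ^ 5 +
        10 * r ^ 11 * (p + q * r) + 5 * r ^ 17 * (p + q * r) ^ 2 + r ^ 23 * (p + q * r) ^ 3)) +
      g 0 * (r ^ 2 * T₈ r) + e₁ * (r ^ 3 * T₉ r) + e₂ * (r ^ 4 * T₁₀ r) + e₃ * (r ^ 5 * T₁₁ r) +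
      (1 + r ^ 6 * (p + q * r)) ^ 12 * h (r * (1 + r ^ 6 * (p + q * r)))) (by fun_prop) fun r => ?_
  rw [hfg, hgh]
  set m := p + q * r with hm
  linear_combination g 0 * r ^ 8 * t₈ r + e₁ * r ^ 9 * t₉ r + e₂ * r ^ 10 * t₁₀ r +
    e₃ * r ^ 11 * t₁₁ r + r ^ 11 * hpq + (4 * w₄ * r ^ 10 + 5 * w₅ * r ^ 11) * hm

theorem exists_cramer {x₁ y₁ x₂ y₂ : ℝ} (h : x₁ * y₂ - x₂ * y₁ ≠ 0) (x y : ℝ) :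
    ∃ a b : ℝ, x = a * x₁ + b * x₂ ∧ y = a * y₁ + b * y₂ := by
  refine ⟨(x * y₂ - x₂ * y) / (x₁ * y₂ - x₂ * y₁), (x₁ * y - x * y₁) / (x₁ * y₂ - x₂ * y₁), ?_, ?_⟩
  all_goals
    rw [div_mul_eq_mul_div, div_mul_eq_mul_div, ← add_div, eq_div_iff h]
    ring

theorem hasFDerivAt_add_mul_add_mul {U V : ℝ × ℝ → ℝ} (hU : ContDiff ℝ ∞ U)
    (hV : ContDiff ℝ ∞ V) (hU0 : U 0 = 0) (hV0 : V 0 = 0) (c x y : ℝ) :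
    HasFDerivAt (fun z : ℝ × ℝ => c + z.1 * (x + U z) + z.2 * (y + V z))
      (x • ContinuousLinearMap.fst ℝ ℝ ℝ + y • ContinuousLinearMap.snd ℝ ℝ ℝ) 0 := by
  have h1 := ((hU.differentiable (by simp)) 0).hasFDerivAt
  have h2 := ((hV.differentiable (by simp)) 0).hasFDerivAt
  refine (((hasFDerivAt_fst.mul (h1.const_add x)).const_add c).add
    (hasFDerivAt_snd.mul (h2.const_add y))).congr_fderiv ?_
  simp [hU0, hV0]

/-- The right-hand sides define a plane map `Φ` carrying the cusp to `γ ∘ θ`. As the `U`s and `V`s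
vanish at the origin, its derivative there has columns `(x₄, y₄)` and `(x₅, y₅)`, so it is a local
diffeomorphism. -/
theorem aEquivalentAtZero_of_comp_eq {γ : ℝ → ℝ × ℝ} {f g θ : ℝ → ℝ}
    (hγ : γ =ᶠ[𝓝 0] fun t => (f t, g t)) (hθ : ContDiff ℝ ∞ θ) (hθ0 : θ 0 = 0)
    (hθ1 : HasDerivAt θ 1 0) {U₁ V₁ U₂ V₂ : ℝ × ℝ → ℝ} (hU₁ : ContDiff ℝ ∞ U₁)
    (hV₁ : ContDiff ℝ ∞ V₁) (hU₂ : ContDiff ℝ ∞ U₂) (hV₂ : ContDiff ℝ ∞ V₂) (hU₁0 : U₁ 0 = 0)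
    (hV₁0 : V₁ 0 = 0) (hU₂0 : U₂ 0 = 0) (hV₂0 : V₂ 0 = 0) {c d x₄ y₄ x₅ y₅ : ℝ}
    (hdet : x₄ * y₅ - x₅ * y₄ ≠ 0)
    (hf : ∀ r, f (θ r) = c + r ^ 4 * (x₄ + U₁ (r ^ 4, r ^ 5)) + r ^ 5 * (x₅ + V₁ (r ^ 4, r ^ 5)))
    (hg : ∀ r, g (θ r) = d + r ^ 4 * (y₄ + U₂ (r ^ 4, r ^ 5)) + r ^ 5 * (y₅ + V₂ (r ^ 4, r ^ 5))) :
    AEquivalentAtZero γ (standardCusp 4 5) := by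
  let Φ : ℝ × ℝ → ℝ × ℝ := fun z => (c + z.1 * (x₄ + U₁ z) + z.2 * (x₅ + V₁ z),
    d + z.1 * (y₄ + U₂ z) + z.2 * (y₅ + V₂ z))
  have hΦ : ContDiff ℝ ∞ Φ := by fun_prop
  obtain ⟨L, hL⟩ := exists_equiv_planeLinearMap (u := (x₄, y₄)) (v := (x₅, y₅)) (by
    simpa only [planeDet, Matrix.det_fin_two_of] using hdet)
  have hΦL : HasFDerivAt Φ (L : ℝ × ℝ →L[ℝ] ℝ × ℝ) 0 := by
    refine ((hasFDerivAt_add_mul_add_mul hU₁ hV₁ hU₁0 hV₁0 c x₄ x₅).prodMk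
      (hasFDerivAt_add_mul_add_mul hU₂ hV₂ hU₂0 hV₂0 d y₄ y₅)).congr_fderiv ?_
    rw [hL]
    ext <;> simp [planeLinearMap]
  obtain ⟨Ψ, hΨ, hΨe⟩ := exists_isDiffeoGerm hΦ L hΦL
  obtain ⟨ψ, hψ, hψe⟩ := exists_isDiffeoGerm hθ (ContinuousLinearEquiv.refl ℝ ℝ) (p := 0)
    (hθ1.hasFDerivAt.congr_fderiv (by ext; simp))
  rw [hθ0] at hψ
  have hc0 : standardCusp 4 5 0 = 0 := by simp [standardCusp]
  have hfg : ∀ r, (f (θ r), g (θ r)) = Φ (standardCusp 4 5 r) := fun r =>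
    Prod.ext (hf r) (hg r)
  have hγ0 : γ 0 = Φ 0 := by
    rw [hγ.eq_of_nhds, ← hc0, ← hfg, hθ0]
  refine ⟨ψ.symm, Ψ.symm, hψ.symm, ?_, ?_⟩
  · rw [hγ0, hc0]
    exact hΨ.symm
  · have hθt : Tendsto θ (𝓝 0) (𝓝 0) := by simpa [hθ0] using hθ.continuous.tendsto 0
    have hct : Tendsto (standardCusp 4 5) (𝓝 0) (𝓝 0) := by
      have : Continuous (standardCusp 4 5) := by
        unfold standardCusp
        fun_prop
      simpa only [hc0] using this.tendsto 0
    filter_upwards [hθt.eventually hγ, hct (Ψ.open_source.mem_nhds hΨ.mem_source)] with r h1 h2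
    rw [OpenPartialHomeomorph.symm_symm, hψe, h1, hfg, ← hΨe]
    exact Ψ.left_inv h2

/-- In the basis `(x₄, y₄)`, `(x₅, y₅)`, write the order 6 vector as `(α, β)` and the order 7 vector
as `(l, k)`. Order 6 determines `a` and `b`, the first coordinate of order 7 determines `c`, and the
second forces `k = 11 / 10 * β ^ 2 + 5 / 4 * α`, which is the hypothesis. -/
theorem exists_reparametrization_coefficients {x₄ x₅ x₆ x₇ y₄ y₅ y₆ y₇ : ℝ}
    (hdet : x₄ * y₅ - x₅ * y₄ ≠ 0)
    (h : 11 * (x₆ * y₄ - x₄ * y₆) ^ 2 =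
      (x₅ * y₄ - x₄ * y₅) * (25 / 2 * (x₆ * y₅ - x₅ * y₆) + 10 * (x₇ * y₄ - x₄ * y₇))) :
    ∃ a b c : ℝ,
      x₄ * (4 * b + 6 * a ^ 2) + x₅ * (5 * a) + x₆ = 0 ∧
      y₄ * (4 * b + 6 * a ^ 2) + y₅ * (5 * a) + y₆ = 0 ∧
      x₄ * (4 * c + 12 * a * b + 4 * a ^ 3) + x₅ * (5 * b + 10 * a ^ 2) + x₆ * (6 * a) + x₇ = 0 ∧
      y₄ * (4 * c + 12 * a * b + 4 * a ^ 3) + y₅ * (5 * b + 10 * a ^ 2) + y₆ * (6 * a) + y₇ = 0 := by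
  obtain ⟨α, β, hx₆, hy₆⟩ := exists_cramer hdet x₆ y₆
  obtain ⟨l, k, hx₇, hy₇⟩ := exists_cramer hdet x₇ y₇
  have hk : k = 11 / 10 * β ^ 2 + 5 / 4 * α := by
    rw [hx₆, hy₆, hx₇, hy₇] at h
    have : (x₄ * y₅ - x₅ * y₄) ^ 2 * (k - (11 / 10 * β ^ 2 + 5 / 4 * α)) = 0 := by
      linear_combination (-1 / 10) * h
    have := (mul_eq_zero.1 this).resolve_left (pow_ne_zero 2 hdet)
    linear_combination this
  refine ⟨-β / 5, -(α + 6 * (-β / 5) ^ 2) / 4, -(l + 6 * (-β / 5) * α +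
    12 * (-β / 5) * (-(α + 6 * (-β / 5) ^ 2) / 4) + 4 * (-β / 5) ^ 3) / 4, ?_, ?_, ?_, ?_⟩
  all_goals
    simp only [hx₆, hy₆, hx₇, hy₇, hk]
    ring

theorem aEquivalentAtZero_of_hasQuarticGerm {γ : ℝ → ℝ × ℝ} {f g : ℝ → ℝ}
    (hγ : γ =ᶠ[𝓝 0] fun t => (f t, g t)) {c d x₄ x₅ x₆ x₇ y₄ y₅ y₆ y₇ : ℝ}
    (hf : HasQuarticGerm f c x₄ x₅ x₆ x₇) (hg : HasQuarticGerm g d y₄ y₅ y₆ y₇)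
    (hdet : x₄ * y₅ - x₅ * y₄ ≠ 0)
    (h : 11 * (x₆ * y₄ - x₄ * y₆) ^ 2 =
      (x₅ * y₄ - x₄ * y₅) * (25 / 2 * (x₆ * y₅ - x₅ * y₆) + 10 * (x₇ * y₄ - x₄ * y₇))) :
    AEquivalentAtZero γ (standardCusp 4 5) := by
  obtain ⟨a₁, a₂, a₃, e1, e2, e3, e4⟩ := exists_reparametrization_coefficients hdet h
  let Q : ℝ → ℝ := fun s => 1 + a₁ * s + a₂ * s ^ 2 + a₃ * s ^ 3
  have hQ : HasCubicJet Q 1 a₁ a₂ a₃ := ⟨fun _ => 0, contDiff_const, fun t => by simp [Q]⟩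
  have hf' := hf.comp hQ
  have hg' := hg.comp hQ
  simp only [one_pow, mul_one] at hf' hg'
  rw [e1, e3] at hf'
  rw [e2, e4] at hg'
  obtain ⟨u, hu⟩ := hf'.exists_eq_comp
  obtain ⟨v, hv⟩ := hg'.exists_eq_comp
  -- The reparametrization adds `4 * a₁` times the order 4 vector to the order 5 vector, so the
  -- determinant is unchanged.
  have hdet' : x₄ * (y₄ * (4 * a₁) + y₅) - (x₄ * (4 * a₁) + x₅) * y₄ ≠ 0 := by
    convert hdet using 1
    ring
  obtain ⟨q, p, hu', hv'⟩ := exists_cramer hdet' (-u) (-v)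
  obtain ⟨U₁, V₁, hU₁, hV₁, hU₁0, hV₁0, hf₁⟩ := hu (p / 5) (q / 4) (by linear_combination -hu')
  obtain ⟨U₂, V₂, hU₂, hV₂, hU₂0, hV₂0, hg₁⟩ := hv (p / 5) (q / 4) (by linear_combination -hv')
  let σ : ℝ → ℝ := fun r => r * (1 + r ^ 6 * (p / 5 + q / 4 * r))
  have hQs := hQ.contDiff
  have hσ : ContDiff ℝ ∞ σ := by fun_prop
  let R : ℝ → ℝ := fun r => (1 + r ^ 6 * (p / 5 + q / 4 * r)) * Q (σ r)
  have hR : ContDiff ℝ ∞ R := by fun_prop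
  have hR0 : R 0 = 1 := by simp [R, Q, σ]
  refine aEquivalentAtZero_of_comp_eq (θ := fun r => σ r * Q (σ r)) hγ (by fun_prop)
    (by simp [σ]) ?_ hU₁ hV₁ hU₂ hV₂ hU₁0 hV₁0 hU₂0 hV₂0 hdet' hf₁ hg₁
  rw [show (fun r => σ r * Q (σ r)) = fun r => r * R r from
    funext fun r => mul_assoc r (1 + r ^ 6 * (p / 5 + q / 4 * r)) (Q (σ r))]
  exact ((hasDerivAt_id (0 : ℝ)).mul (hR.differentiable (by simp) 0).hasDerivAt).congr_deriv
    (by simp [hR0])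

/-! ### The equivalence -/

theorem theorem4p1 (I : Set ℝ) (hI_open : IsOpen I) (hI_interval : I.OrdConnected)
    (hI_zero : (0 : ℝ) ∈ I) (γ : ℝ → ℝ × ℝ) (hγ : ContDiffOn ℝ ∞ γ I)
    (A B C D : ℝ)
    (hA : A = planeDet (iteratedDeriv 5 γ 0) (iteratedDeriv 4 γ 0))
    (hB : B = planeDet (iteratedDeriv 6 γ 0) (iteratedDeriv 4 γ 0))
    (hC : C = planeDet (iteratedDeriv 7 γ 0) (iteratedDeriv 4 γ 0))
    (hD : D = planeDet (iteratedDeriv 6 γ 0) (iteratedDeriv 5 γ 0)) :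
    AEquivalentAtZero γ (standardCusp 4 5) ↔
      iteratedDeriv 1 γ 0 = 0 ∧ iteratedDeriv 2 γ 0 = 0 ∧ iteratedDeriv 3 γ 0 = 0 ∧
        A ≠ 0 ∧ -77 * B ^ 2 + 105 * A * D + 60 * A * C = 0 := by
  have hI : I ∈ 𝓝 (0 : ℝ) := hI_open.mem_nhds hI_zero
  simp only [planeDet, Matrix.det_fin_two_of] at hA hB hC hD
  constructor
  · intro h
    obtain ⟨x₄, x₅, y₄, y₅, a₀, a₁, a₂, a₃, hdet, ha₀, f, g, hfg, hf, hg, hjf, hjg⟩ :=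
      exists_hasQuarticGerm_of_aEquivalentAtZero (hγ.continuousOn.continuousAt hI) h
    have hd : ∀ k, iteratedDeriv k γ 0 = (iteratedDeriv k f 0, iteratedDeriv k g 0) := fun k => by
      rw [hfg.iteratedDeriv_eq k, iteratedDeriv_prodMk hf hg]
    obtain ⟨f1, f2, f3, f4, f5, f6, f7⟩ := hjf.iteratedDeriv_eq
    obtain ⟨g1, g2, g3, g4, g5, g6, g7⟩ := hjg.iteratedDeriv_eq
    simp only [hd, f4, f5, f6, f7, g4, g5, g6, g7] at hA hB hC hD
    have hA' : A = -(2880 * a₀ ^ 9) * (x₄ * y₅ - x₅ * y₄) := by rw [hA]; ring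
    refine ⟨by simp [hd, f1, g1], by simp [hd, f2, g2], by simp [hd, f3, g3], ?_, ?_⟩
    · rw [hA']
      exact mul_ne_zero (neg_ne_zero.2 (mul_ne_zero (by norm_num) (pow_ne_zero _ ha₀))) hdet
    · rw [hA, hB, hC, hD]
      ring
  · rintro ⟨h1, h2, h3, hA0, h⟩
    obtain ⟨δ, hδ, hδγ⟩ := exists_contDiff_eventuallyEq hI hγ
    have hf : ContDiff ℝ ∞ fun t => (δ t).1 := by fun_prop
    have hg : ContDiff ℝ ∞ fun t => (δ t).2 := by fun_prop
    have hfg : γ =ᶠ[𝓝 0] fun t => ((δ t).1, (δ t).2) := hδγ.symm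
    have hd : ∀ k, iteratedDeriv k γ 0 =
        (iteratedDeriv k (fun t => (δ t).1) 0, iteratedDeriv k (fun t => (δ t).2) 0) := fun k => by
      rw [hfg.iteratedDeriv_eq k, iteratedDeriv_prodMk hf hg]
    rw [hd, Prod.mk_eq_zero] at h1 h2 h3
    simp only [hd] at hA hB hC hD
    refine aEquivalentAtZero_of_hasQuarticGerm hfg
      (hasQuarticGerm_of_iteratedDeriv hf h1.1 h2.1 h3.1)
      (hasQuarticGerm_of_iteratedDeriv hg h1.2 h2.2 h3.2) ?_ ?_
    · contrapose! hA0
      rw [hA]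
      linear_combination (-2880) * hA0
    · rw [hA, hB, hC, hD] at h
      -- In Taylor coefficients `B` carries the factor `720 * 24 = 17280`, and `77 = 7 * 11`.
      linear_combination (-1 / (7 * 17280 ^ 2)) * h
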